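/- Work in the first-order language with equality and one binary relation symbol $\in$. A formula is stratifiable if natural numbers (types) can be assigned to its variables (with different quantifiers binding different variables) so that $u$ and $w$ have the same type whenever $u=w$ occurs, and the type of $w$ is the type of $u$ plus one whenever $u\in w$ occurs. NFU (New Foundations with urelements) is the theory with the axioms * extensionality for objects that have an element: $\forall x\forall y\,\bigl(\exists z\,(z\in x)\wedge\forall z\,(z\in x\leftrightarrow z\in y)\rightarrow x=y\bigr)$; * stratified comprehension: $\forall \vec x\,\exists y\,\forall z\,\bigl(z\in y\leftrightarrow\Phi(\vec x,z)\bigr)$ for every stratifiable formula $\Phi$ in which $y$ is not free. Choice is the axiom: for every set $P$ of nonempty, pairwise disjoint sets there is a set $C$ that has exactly one element in common with each $A\in P$. Let $\langle x,y\rangle=\{\{x\},\{x,y\}\}$. An object $x$ is strongly cantorian if the graph $\{\langle y,\{y\}\rangle : y\in x\}$ of the singleton function restricted to $x$ is a set, i.e. there is $g$ such that for all $p$, $p\in g$ if and only if $p=\langle y,\{y\}\rangle$ for some $y\in x$. SCU is the sentence: if $X$ is strongly cantorian and every element of $X$ is strongly cantorian, then the union $\bigcup X=\{z : \exists y\in X\;(z\in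 y)\}$ exists and is strongly cantorian (if $\bigcup X$ is empty, this is asserted of every object without elements). **Theorem.** SCU is a theorem of NFU + Choice; that is, SCU holds in every model of NFU + Choice. -/

import Mathlib

open FirstOrder FirstOrder.Language FirstOrder.Language.Theory

namespace NFU

/-- The only non-logical symbol is the binary relation symbol of membership. -/
inductive SetRel : ℕ → Type
  | mem : SetRel 2

/-- The first-order language of set theory: equality and membership. -/
def L : FirstOrder.Language.{0, 0} := ⟨fun _ => Empty, SetRel⟩

/-- Formulas whose free variables are `x₀, …, xₙ₋₁`. Variables are numbered from the outside, so
in `∀' φ` and `∃' φ` the quantified variable of `φ : Fml (n + 1)` is `xₙ = Fin.last n`, while the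
older variable `xᵢ` is `i.castSucc`. -/
abbrev Fml (n : ℕ) := L.BoundedFormula Empty n

/-! ### Stratification -/

/-- The type of a term under a type assignment `ρ` (every term is a variable). -/
def termType {β : Type} (ρ : β → ℕ) : L.Term β → ℕ
  | .var v => ρ v
  | .func f _ => Empty.elim f

/-- `StratifiedBy φ σ`: the assignment `σ` of types to the free variables of `φ` extends to a
stratification of `φ`. Different quantifiers bind different variables, so each of them chooses the
type of its own variable. -/
def StratifiedBy : {n : ℕ} → Fml n → (Fin n → ℕ) → Prop
  | _, .falsum, _ => True
  | _, .equal s t, σ => termType (Sum.elim Empty.elim σ) s = termType (Sum.elim Empty.elim σ) t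
  | _, .rel SetRel.mem ts, σ =>
      termType (Sum.elim Empty.elim σ) (ts 0) + 1 = termType (Sum.elim Empty.elim σ) (ts 1)
  | _, .imp φ ψ, σ => StratifiedBy φ σ ∧ StratifiedBy ψ σ
  | n, .all φ, σ => ∃ k : ℕ, StratifiedBy φ (Fin.snoc (α := fun _ : Fin (n + 1) => ℕ) σ k)

/-- A formula is stratifiable if it has a stratification. -/
def Stratifiable {n : ℕ} (φ : Fml n) : Prop := ∃ σ : Fin n → ℕ, StratifiedBy φ σ

/-! ### Abbreviations in the language -/

/-- The variable `xᵢ` as a term. -/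
def v {n : ℕ} (i : Fin n) : L.Term (Empty ⊕ Fin n) := .var (Sum.inr i)

/-- `a ∈ b` -/
def mem {n : ℕ} (a b : Fin n) : Fml n := .rel SetRel.mem ![v a, v b]

/-- `a = b` -/
def eq {n : ℕ} (a b : Fin n) : Fml n := .equal (v a) (v b)

/-- `s = {x}` -/
def isSingleton {n : ℕ} (s x : Fin n) : Fml n :=
  ∀' (mem (Fin.last n) s.castSucc ⇔ eq (Fin.last n) x.castSucc)

/-- `s = {x, y}` -/
def isUnorderedPair {n : ℕ} (s x y : Fin n) : Fml n :=
  ∀' (mem (Fin.last n) s.castSucc ⇔ (eq (Fin.last n) x.castSucc ⊔ eq (Fin.last n) y.castSucc))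

/-- `p = ⟨x, y⟩`, the Wiener–Kuratowski pair `{{x}, {x, y}}`, in which `x` and `y` have the same
type. -/
def isPair {n : ℕ} (p x y : Fin n) : Fml n :=
  ∀' (mem (Fin.last n) p.castSucc ⇔
    (isSingleton (Fin.last n) x.castSucc ⊔
      isUnorderedPair (Fin.last n) x.castSucc y.castSucc))

/-- `p = ⟨y, {y}⟩` for some `y ∈ x` -/
def inSingletonGraph {n : ℕ} (p x : Fin n) : Fml n :=
  ∃' (mem (Fin.last n) x.castSucc ⊓
    ∃' (isSingleton (Fin.last (n + 1)) (Fin.last n).castSucc ⊓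
      isPair p.castSucc.castSucc (Fin.last n).castSucc (Fin.last (n + 1))))

/-- `x` is strongly cantorian: the graph `{⟨y, {y}⟩ | y ∈ x}` of the singleton function restricted
to `x` is a set. -/
def stronglyCantorian {n : ℕ} (x : Fin n) : Fml n :=
  ∃' ∀' (mem (Fin.last (n + 1)) (Fin.last n).castSucc ⇔
    inSingletonGraph (Fin.last (n + 1)) x.castSucc.castSucc)

/-- `u = ⋃ X` -/
def isUnion {n : ℕ} (u X : Fin n) : Fml n :=
  ∀' (mem (Fin.last n) u.castSucc ⇔
    ∃' (mem (Fin.last (n + 1)) X.castSucc.castSucc ⊓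
      mem (Fin.last n).castSucc (Fin.last (n + 1))))

/-! ### The axioms -/

/-- Extensionality for objects that have an element:
`∀ x y, (∃ z, z ∈ x) ∧ (∀ z, z ∈ x ↔ z ∈ y) → x = y`. -/
def extensionality : L.Sentence :=
  ∀' ∀' (((∃' (mem 2 0 : Fml 3)) ⊓ ∀' ((mem 2 0 : Fml 3) ⇔ mem 2 1)) ⟹ (eq 0 1 : Fml 2))

/-- Comprehension for a formula `φ(x₀, …, xₙ₋₁, z)` with parameters `x₀, …, xₙ₋₁`:
`∀ x₀ … xₙ₋₁, ∃ y, ∀ z, z ∈ y ↔ φ(x₀, …, xₙ₋₁, z)`.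
Here `φ.liftAt 1 n` renames `z` from `xₙ` to `xₙ₊₁` and makes room for `y = xₙ`, which does not
occur in it. -/
def comprehension {n : ℕ} (φ : Fml (n + 1)) : L.Sentence :=
  BoundedFormula.alls (n := n)
    (∃' ∀' (mem (Fin.last (n + 1)) (Fin.last n).castSucc ⇔
      (φ.liftAt 1 n : Fml (n + 1 + 1))))

/-- New Foundations with urelements: extensionality for objects that have an element, and
comprehension for all stratifiable formulas. -/
def theory : L.Theory :=
  {extensionality} ∪
    {ψ | ∃ (n : ℕ) (φ : Fml (n + 1)), Stratifiable φ ∧ ψ = comprehension φ}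

/-- The axiom of choice: for every set `P` of nonempty, pairwise disjoint sets there is a set `C`
that has exactly one element in common with every `A ∈ P`. -/
def choice : L.Sentence :=
  ∀' (((∀' ((mem 1 0 : Fml 2) ⟹ ∃' (mem 2 1 : Fml 3))) ⊓
      (∀' ∀' (((mem 1 0 : Fml 3) ⊓ mem 2 0 ⊓ ∃' ((mem 3 1 : Fml 4) ⊓ mem 3 2)) ⟹ eq 1 2))) ⟹
    (∃' ∀' ((mem 2 0 : Fml 3) ⟹
      ∃' ∀' (((mem 4 2 : Fml 5) ⊓ mem 4 1) ⇔ eq 4 3)) : Fml 1))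

/-- SCU: if `X` is strongly cantorian and all its elements are strongly cantorian, then `⋃ X`
exists and is strongly cantorian. (If `⋃ X` is empty, every object without elements is a value of
`⋃ X`.) -/
def SCU : L.Sentence :=
  ∀' ((stronglyCantorian (0 : Fin 1) ⊓ ∀' ((mem 1 0 : Fml 2) ⟹ stronglyCantorian 1)) ⟹
    ((∃' (isUnion 1 0 : Fml 2)) ⊓ ∀' ((isUnion 1 0 : Fml 2) ⟹ stronglyCantorian 1)))

end NFU

/-! If each `y ∈ X` has a singleton graph `g_y`, the union of these graphs is the singleton graph of
`⋃ X`. The difficulty is to form this union by stratified comprehension: "`p = ⟨a, {a}⟩` for some `a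
∈ y`" is not stratified, and the graphs are not given as a function of `y`.

Choice yields one set `C` coding a choice function on all nonempty sets (`exists_isChoice`). With
it, `g_y` is the least relation `h` such that, whenever `h` matches the complements of `A` and `B`
in `y`, it relates the chosen elements of `A` and `B` (`IsSingGraph.mem_iff`). No well-ordering is
needed.

This definition of `g_y` is stratified once its second occurrence of `y` becomes a variable `z` one
type lower (`StratDef.isClosedRel`). The singleton graph of `X` then serves to say `y = z` across
the two types, so comprehension gives the union of the `g_y`. -/

namespace NFU

section Semantics

variable {M : Type*} [L.Structure M]

/-- The membership relation of an `L`-structure. -/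
def E (x y : M) : Prop := Structure.RelMap (L := L) SetRel.mem ![x, y]

/-- `s = {x}`. -/
def IsSing (s x : M) : Prop := ∀ z, E z s ↔ z = x

/-- `s = {x, y}`. -/
def IsUPair (s x y : M) : Prop := ∀ z, E z s ↔ (z = x ∨ z = y)

/-- `p` is the ordered pair `⟨x, y⟩`. -/
def IsOPair (p x y : M) : Prop := ∀ z, E z p ↔ (IsSing z x ∨ IsUPair z x y)

/-- `p = ⟨x, {y}⟩` -/
def IsSPair (p x y : M) : Prop := ∃ s, IsSing s y ∧ IsOPair p x s

/-- `⟨x, {y}⟩ ∈ r` -/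
def SRel (r x y : M) : Prop := ∃ p, E p r ∧ IsSPair p x y

/-- `g` is the graph of the singleton function on `x`. -/
def IsSingGraph (g x : M) : Prop := ∀ p, E p g ↔ ∃ y, E y x ∧ IsSPair p y y

/-! ### Realization of the formulas -/

@[simp] theorem realize_mem {n : ℕ} (w : Empty → M) (xs : Fin n → M) (a b : Fin n) :
    (mem a b).Realize w xs ↔ E (xs a) (xs b) := by
  unfold mem E BoundedFormula.Realize
  refine iff_of_eq (congrArg _ ?_)
  funext i
  fin_cases i <;> rfl

@[simp] theorem realize_eq {n : ℕ} (w : Empty → M) (xs : Fin n → M) (a b : Fin n) :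
    (eq a b).Realize w xs ↔ xs a = xs b := Iff.rfl

@[simp] theorem realize_isSingleton {n : ℕ} (w : Empty → M) (xs : Fin n → M) (s x : Fin n) :
    (isSingleton s x).Realize w xs ↔ IsSing (xs s) (xs x) := by
  simp [isSingleton, IsSing]

@[simp] theorem realize_isUnorderedPair {n : ℕ} (w : Empty → M) (xs : Fin n → M)
    (s x y : Fin n) :
    (isUnorderedPair s x y).Realize w xs ↔ IsUPair (xs s) (xs x) (xs y) := by
  simp [isUnorderedPair, IsUPair]

@[simp] theorem realize_isPair {n : ℕ} (w : Empty → M) (xs : Fin n → M) (p x y : Fin n) :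
    (isPair p x y).Realize w xs ↔ IsOPair (xs p) (xs x) (xs y) := by
  simp [isPair, IsOPair]

@[simp] theorem realize_inSingletonGraph {n : ℕ} (w : Empty → M) (xs : Fin n → M)
    (p x : Fin n) :
    (inSingletonGraph p x).Realize w xs ↔ ∃ y, E y (xs x) ∧ IsSPair (xs p) y y := by
  simp [inSingletonGraph, IsSPair]

@[simp] theorem realize_stronglyCantorian {n : ℕ} (w : Empty → M) (xs : Fin n → M)
    (x : Fin n) :
    (stronglyCantorian x).Realize w xs ↔ ∃ g, IsSingGraph g (xs x) := by
  simp [stronglyCantorian, IsSingGraph]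

@[simp] theorem realize_isUnion {n : ℕ} (w : Empty → M) (xs : Fin n → M) (u X : Fin n) :
    (isUnion u X).Realize w xs ↔ ∀ z, E z (xs u) ↔ ∃ y, E y (xs X) ∧ E z y := by
  simp [isUnion]

theorem realize_extensionality (h : M ⊨ extensionality) {x y z : M} (hz : E z x)
    (hxy : ∀ z, E z x ↔ E z y) : x = y := by
  simp [extensionality, Sentence.Realize, Formula.Realize, Fin.snoc] at h
  exact h x y z hz hxy

theorem realize_choice (h : M ⊨ choice) (P : M) (hne : ∀ A, E A P → ∃ a, E a A)
    (hdisj : ∀ A B, E A P → E B P → ∀ a, E a A → E a B → A = B) :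
    ∃ C, ∀ A, E A P → ∃ a, ∀ b, (E b C ∧ E b A) ↔ b = a := by
  simp [choice, Sentence.Realize, Formula.Realize, Fin.snoc] at h
  obtain ⟨C, hC⟩ := h P hne hdisj
  exact ⟨C, fun A hA => by simpa only [and_comm] using hC A hA⟩

theorem realize_SCU : M ⊨ SCU ↔ ∀ X : M, (∃ j, IsSingGraph j X) →
    (∀ y, E y X → ∃ g, IsSingGraph g y) →
    (∃ u : M, ∀ z, E z u ↔ ∃ y, E y X ∧ E z y) ∧
    ∀ u : M, (∀ z, E z u ↔ ∃ y, E y X ∧ E z y) → ∃ g, IsSingGraph g u := by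
  simp [SCU, Sentence.Realize, Formula.Realize, Fin.snoc]

theorem realize_comprehension {n : ℕ} {φ : Fml (n + 1)} (h : M ⊨ comprehension φ)
    (xs : Fin n → M) :
    ∃ y, ∀ z, E z y ↔ φ.Realize default (Fin.snoc xs z : Fin (n + 1) → M) := by
  have hx := BoundedFormula.realize_alls.1 h xs
  simp only [BoundedFormula.realize_ex, BoundedFormula.realize_all, BoundedFormula.realize_iff,
    realize_mem, Fin.snoc_castSucc, Fin.snoc_last,
    BoundedFormula.realize_liftAt_one (Nat.le_succ n)] at hx
  obtain ⟨y, hy⟩ := hx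
  refine ⟨y, fun z => (hy z).trans (iff_of_eq (congrArg _ ?_))⟩
  -- The renamed formula skips index `n`, the place of `y`, so its variables again take the values
  -- `xs` followed by `z`.
  funext i
  refine Fin.lastCases ?_ (fun i => ?_) i
  · simp [Fin.succ_last, Fin.snoc_last]
  · simp

/-! ### Relations definable by stratified formulas -/

/-- `f` picks out a variable of type `k`. -/
def IsVar {n : ℕ} (σ : Fin n → ℕ) (k : ℕ) (f : (Fin n → M) → M) : Prop :=
  ∃ i, σ i = k ∧ ∀ x, f x = x i

/-- `R` is defined by a formula that is stratified by the types `σ` of its free variables. -/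
def StratDef {n : ℕ} (σ : Fin n → ℕ) (R : (Fin n → M) → Prop) : Prop :=
  ∃ φ : Fml n, StratifiedBy φ σ ∧ ∀ x, φ.Realize default x ↔ R x

variable {n : ℕ} {σ : Fin n → ℕ} {k : ℕ} {f g h : (Fin n → M) → M}
  {R S : (Fin n → M) → Prop}

omit [L.Structure M] in
theorem IsVar.last : IsVar (Fin.snoc σ k : Fin (n + 1) → ℕ) k
    (fun x : Fin (n + 1) → M => x (Fin.last n)) :=
  ⟨Fin.last n, by simp, fun _ => rfl⟩

omit [L.Structure M] in
theorem IsVar.lift {j : ℕ} (hf : IsVar σ k f) :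
    IsVar (Fin.snoc σ j : Fin (n + 1) → ℕ) k
      (fun x : Fin (n + 1) → M => f (Fin.init (α := fun _ => M) x)) := by
  obtain ⟨i, hi, hf⟩ := hf
  exact ⟨i.castSucc, by simpa using hi, fun x => hf _⟩

namespace StratDef

theorem mem (hf : IsVar σ k f) (hg : IsVar σ (k + 1) g) :
    StratDef σ (fun x => E (f x) (g x)) := by
  obtain ⟨i, hi, hf⟩ := hf
  obtain ⟨j, hj, hg⟩ := hg
  refine ⟨NFU.mem i j, ?_, fun x => by simp [hf, hg]⟩
  change σ i + 1 = σ j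
  rw [hi, hj]

theorem eq (hf : IsVar σ k f) (hg : IsVar σ k g) :
    StratDef σ (fun x => f x = g x) := by
  obtain ⟨i, hi, hf⟩ := hf
  obtain ⟨j, hj, hg⟩ := hg
  refine ⟨NFU.eq i j, ?_, fun x => by simp [hf, hg]⟩
  change σ i = σ j
  rw [hi, hj]

theorem imp (hR : StratDef σ R) (hS : StratDef σ S) : StratDef σ (fun x => R x → S x) := by
  obtain ⟨φ, hφ, hR⟩ := hR
  obtain ⟨ψ, hψ, hS⟩ := hS
  exact ⟨φ.imp ψ, ⟨hφ, hψ⟩, fun x => by simp [hR, hS]⟩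

theorem false : StratDef σ (fun _ : Fin n → M => False) := ⟨.falsum, trivial, fun _ => Iff.rfl⟩

theorem congr (hR : StratDef σ R) (hRS : ∀ x, R x ↔ S x) : StratDef σ S :=
  (funext fun x => propext (hRS x) : R = S) ▸ hR

theorem not (hR : StratDef σ R) : StratDef σ (fun x => ¬ R x) := hR.imp false

theorem and (hR : StratDef σ R) (hS : StratDef σ S) : StratDef σ (fun x => R x ∧ S x) :=
  (hR.imp hS.not).not.congr fun x => by tauto

theorem or (hR : StratDef σ R) (hS : StratDef σ S) : StratDef σ (fun x => R x ∨ S x) :=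
  (hR.not.imp hS).congr fun x => by tauto

theorem iff (hR : StratDef σ R) (hS : StratDef σ S) : StratDef σ (fun x => R x ↔ S x) :=
  ((hR.imp hS).and (hS.imp hR)).congr fun x => by tauto

theorem all (k : ℕ) {R : (Fin n → M) → M → Prop}
    (hR : StratDef (Fin.snoc σ k : Fin (n + 1) → ℕ)
      (fun x : Fin (n + 1) → M => R (Fin.init (α := fun _ => M) x) (x (Fin.last n)))) :
    StratDef σ (fun x => ∀ y, R x y) := by
  obtain ⟨φ, hφ, hR⟩ := hR
  exact ⟨φ.all, ⟨k, hφ⟩, fun x => by simp [hR]⟩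

theorem ex (k : ℕ) {R : (Fin n → M) → M → Prop}
    (hR : StratDef (Fin.snoc σ k : Fin (n + 1) → ℕ)
      (fun x : Fin (n + 1) → M => R (Fin.init (α := fun _ => M) x) (x (Fin.last n)))) :
    StratDef σ (fun x => ∃ y, R x y) :=
  (all k (R := fun x y => ¬ R x y) hR.not).not.congr fun x => by simp

theorem isSing (hf : IsVar σ (k + 1) f) (hg : IsVar σ k g) :
    StratDef σ (fun x => IsSing (f x) (g x)) :=
  all k ((mem .last hf.lift).iff (eq .last hg.lift))

theorem isUPair (hf : IsVar σ (k + 1) f) (hg : IsVar σ k g) (hh : IsVar σ k h) :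
    StratDef σ (fun x => IsUPair (f x) (g x) (h x)) :=
  all k ((mem .last hf.lift).iff ((eq .last hg.lift).or (eq .last hh.lift)))

theorem isOPair (hf : IsVar σ (k + 2) f) (hg : IsVar σ k g) (hh : IsVar σ k h) :
    StratDef σ (fun x => IsOPair (f x) (g x) (h x)) :=
  all (k + 1) ((mem .last hf.lift).iff
    ((isSing .last hg.lift).or (isUPair .last hg.lift hh.lift)))

/-- Passing to `{y}` absorbs the gap between the types of the two components, so such pairs code
relations from one type to the type below. -/
theorem isSPair (hf : IsVar σ (k + 3) f) (hg : IsVar σ (k + 1) g) (hh : IsVar σ k h) :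
    StratDef σ (fun x => IsSPair (f x) (g x) (h x)) :=
  ex (k + 1) ((isSing .last hh.lift).and (isOPair hf.lift hg.lift .last))

theorem sRel (hf : IsVar σ (k + 4) f) (hg : IsVar σ (k + 1) g) (hh : IsVar σ k h) :
    StratDef σ (fun x => SRel (f x) (g x) (h x)) :=
  ex (k + 3) ((mem .last hf.lift).and (isSPair .last hg.lift hh.lift))

theorem exists_set (hM : M ⊨ theory) {σ : Fin (n + 1) → ℕ} {R : (Fin (n + 1) → M) → Prop}
    (hR : StratDef σ R) (xs : Fin n → M) :
    ∃ y, ∀ z, E z y ↔ R (Fin.snoc xs z : Fin (n + 1) → M) := by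
  obtain ⟨φ, hφ, hR⟩ := hR
  have hc : M ⊨ comprehension φ := hM.realize_of_mem _ (.inr ⟨n, φ, ⟨σ, hφ⟩, rfl⟩)
  obtain ⟨y, hy⟩ := realize_comprehension hc xs
  exact ⟨y, fun z => (hy z).trans (hR _)⟩

end StratDef

/-! ### Pairs -/

theorem ext (hM : M ⊨ theory) {x y z : M} (hz : E z x) (hxy : ∀ z, E z x ↔ E z y) : x = y :=
  realize_extensionality (hM.realize_of_mem _ (.inl rfl)) hz hxy

theorem exists_isUPair (hM : M ⊨ theory) (a b : M) : ∃ s : M, IsUPair s a b :=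
  StratDef.exists_set hM (n := 2) (σ := ![0, 0, 0]) (R := fun x => x 2 = x 0 ∨ x 2 = x 1)
    (.or (.eq (k := 0) ⟨2, rfl, fun _ => rfl⟩ ⟨0, rfl, fun _ => rfl⟩)
      (.eq (k := 0) ⟨2, rfl, fun _ => rfl⟩ ⟨1, rfl, fun _ => rfl⟩)) ![a, b]

theorem exists_isSing (hM : M ⊨ theory) (a : M) : ∃ s : M, IsSing s a := by
  simpa [IsUPair, IsSing] using exists_isUPair hM a a

theorem IsSing.unique (hM : M ⊨ theory) {s t x : M} (hs : IsSing s x) (ht : IsSing t x) :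
    s = t :=
  ext hM ((hs x).2 rfl) fun z => (hs z).trans (ht z).symm

theorem IsUPair.unique (hM : M ⊨ theory) {s t x y : M} (hs : IsUPair s x y)
    (ht : IsUPair t x y) : s = t :=
  ext hM ((hs x).2 (.inl rfl)) fun z => (hs z).trans (ht z).symm

theorem exists_isOPair (hM : M ⊨ theory) (x y : M) : ∃ p : M, IsOPair p x y := by
  obtain ⟨s, hs⟩ := exists_isSing hM x
  obtain ⟨t, ht⟩ := exists_isUPair hM x y
  obtain ⟨p, hp⟩ := exists_isUPair hM s t
  refine ⟨p, fun z => (hp z).trans (or_congr ⟨?_, fun h => h.unique hM hs⟩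
    ⟨?_, fun h => h.unique hM ht⟩)⟩
  · rintro rfl; exact hs
  · rintro rfl; exact ht

theorem IsOPair.unique (hM : M ⊨ theory) {p q x y : M} (hp : IsOPair p x y)
    (hq : IsOPair q x y) : p = q := by
  obtain ⟨s, hs⟩ := exists_isSing hM x
  exact ext hM ((hp s).2 (.inl hs)) fun z => (hp z).trans (hq z).symm

theorem IsOPair.inj (hM : M ⊨ theory) {p x y x' y' : M} (hp : IsOPair p x y)
    (hp' : IsOPair p x' y') : x = x' ∧ y = y' := by
  obtain ⟨s, hs⟩ := exists_isSing hM x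
  obtain ⟨t, ht⟩ := exists_isUPair hM x y
  obtain ⟨t', ht'⟩ := exists_isUPair hM x' y'
  have h1 := (hp' s).1 ((hp s).2 (.inl hs))
  have h2 := (hp' t).1 ((hp t).2 (.inr ht))
  have h3 := (hp t').1 ((hp' t').2 (.inr ht'))
  unfold IsSing IsUPair at *
  -- Either alternative in `h1` puts `x'` into `s = {x}`.
  have hx : x = x' := by
    have := hs x
    have := hs x'
    grind
  subst hx
  have := ht y
  have := ht' y'
  exact ⟨rfl, by grind⟩

theorem exists_isSPair (hM : M ⊨ theory) (x y : M) : ∃ p : M, IsSPair p x y := by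
  obtain ⟨s, hs⟩ := exists_isSing hM y
  obtain ⟨p, hp⟩ := exists_isOPair hM x s
  exact ⟨p, s, hs, hp⟩

theorem IsSPair.unique (hM : M ⊨ theory) {p q x y : M} (hp : IsSPair p x y)
    (hq : IsSPair q x y) : p = q := by
  obtain ⟨s, hs, hp⟩ := hp
  obtain ⟨t, ht, hq⟩ := hq
  obtain rfl := hs.unique hM ht
  exact hp.unique hM hq

theorem IsSPair.inj (hM : M ⊨ theory) {p x y x' y' : M} (hp : IsSPair p x y)
    (hp' : IsSPair p x' y') : x = x' ∧ y = y' := by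
  obtain ⟨s, hs, hp⟩ := hp
  obtain ⟨t, ht, hp'⟩ := hp'
  obtain ⟨rfl, rfl⟩ := hp.inj hM hp'
  exact ⟨rfl, (ht y).1 ((hs y).2 rfl)⟩

theorem sRel_iff (hM : M ⊨ theory) {r p x y : M} (hp : IsSPair p x y) :
    SRel r x y ↔ E p r :=
  ⟨fun ⟨_, hq, hq'⟩ => hp.unique hM hq' ▸ hq, fun h => ⟨p, h, hp⟩⟩

theorem IsSingGraph.sRel_iff (hM : M ⊨ theory) {g x y z : M} (hg : IsSingGraph g x) :
    SRel g y z ↔ E y x ∧ y = z := by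
  constructor
  · rintro ⟨p, hp, hyz⟩
    obtain ⟨w, hw, hpw⟩ := (hg p).1 hp
    obtain ⟨rfl, rfl⟩ := hyz.inj hM hpw
    exact ⟨hw, rfl⟩
  · rintro ⟨hy, rfl⟩
    obtain ⟨p, hp⟩ := exists_isSPair hM y y
    exact ⟨p, (hg p).2 ⟨y, hy, hp⟩, hp⟩

/-! ### A universal choice function -/

/-- `C` codes a choice function on the nonempty sets: it contains `⟨A, {a}⟩` for exactly one
element `a` of `A`. -/
def IsChoice (C : M) : Prop :=
  ∀ A : M, (∃ a, E a A) → ∃ a, E a A ∧ ∀ b, (E b A ∧ SRel C A b) ↔ b = a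

/-- Replacing each nonempty `A` by the set of all `⟨A, {a}⟩` with `a ∈ A` makes the family disjoint,
since a pair determines its first component. A transversal of this family codes a choice function.
-/
theorem exists_isChoice (hM : M ⊨ theory) (hC : M ⊨ choice) : ∃ C : M, IsChoice C := by
  have hS (A : M) : ∃ s : M, ∀ p, E p s ↔ ∃ a, E a A ∧ IsSPair p A a :=
    StratDef.exists_set hM (n := 1) (σ := ![1, 3])
      (R := fun x => ∃ a, E a (x 0) ∧ IsSPair (x 1) (x 0) a)
      (have v0 : IsVar (M := M) ![1, 3] 1 (fun x => x 0) := ⟨0, rfl, fun _ => rfl⟩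
       have v1 : IsVar (M := M) ![1, 3] 3 (fun x => x 1) := ⟨1, rfl, fun _ => rfl⟩
       .ex 0 (.and (.mem .last v0.lift) (.isSPair v1.lift v0.lift .last))) ![A]
  obtain ⟨P, hP⟩ : ∃ P : M, ∀ s, E s P ↔
      ∃ A, (∃ a, E a A) ∧ ∀ p, E p s ↔ ∃ a, E a A ∧ IsSPair p A a :=
    StratDef.exists_set hM (n := 0) (σ := ![4])
      (R := fun x => ∃ A, (∃ a, E a A) ∧ ∀ p, E p (x 0) ↔ ∃ a, E a A ∧ IsSPair p A a)
      (have v0 : IsVar (M := M) ![4] 4 (fun x => x 0) := ⟨0, rfl, fun _ => rfl⟩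
       .ex 1 (.and (.ex 0 (.mem .last IsVar.last.lift)) (.all 3 (.iff (.mem .last v0.lift.lift)
        (.ex 0 (.and (.mem .last IsVar.last.lift.lift)
          (.isSPair IsVar.last.lift IsVar.last.lift.lift .last))))))) ![]
  obtain ⟨C, hC⟩ := realize_choice hC P (fun s hs => by
      obtain ⟨A, ⟨a, ha⟩, hA⟩ := (hP s).1 hs
      obtain ⟨p, hp⟩ := exists_isSPair hM A a
      exact ⟨p, (hA p).2 ⟨a, ha, hp⟩⟩)
    (fun s t hs ht p hps hpt => by
      obtain ⟨A, -, hA⟩ := (hP s).1 hs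
      obtain ⟨B, -, hB⟩ := (hP t).1 ht
      obtain ⟨a, -, ha⟩ := (hA p).1 hps
      obtain ⟨b, -, hb⟩ := (hB p).1 hpt
      obtain ⟨rfl, -⟩ := ha.inj hM hb
      -- The common element `p` is what extensionality requires in the presence of urelements.
      exact ext hM hps fun q => (hA q).trans (hB q).symm)
  refine ⟨C, fun A hne => ?_⟩
  obtain ⟨s, hs⟩ := hS A
  obtain ⟨p, hp⟩ := hC s ((hP s).2 ⟨A, hne, hs⟩)
  obtain ⟨hpC, hps⟩ := (hp p).2 rfl
  obtain ⟨a, ha, hpa⟩ := (hs p).1 hps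
  refine ⟨a, ha, fun b => ⟨fun ⟨hb, q, hq, hqb⟩ => ?_, ?_⟩⟩
  · obtain rfl := (hp q).1 ⟨hq, (hs q).2 ⟨b, hb, hqb⟩⟩
    exact (hqb.inj hM hpa).2
  · rintro rfl
    exact ⟨ha, p, hpC, hpa⟩

/-! ### A uniform definition of the singleton function -/

/-- Every element of `y` outside `A` is related by `h` to an element of `z` outside `B`, and
conversely. -/
def Matches (h y z A B : M) : Prop :=
  (∀ a, E a y → ¬ E a A → ∃ b, E b z ∧ ¬ E b B ∧ SRel h a b) ∧
    ∀ b, E b z → ¬ E b B → ∃ a, E a y ∧ ¬ E a A ∧ SRel h a b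

/-- Whenever `h` matches the complements of `A` in `y` and of `B` in `z`, it relates the chosen
elements of `A` and `B`. -/
def IsClosedRel (C D h y z : M) : Prop :=
  ∀ A B : M, (∀ a, E a A → E a y) → (∀ b, E b B → E b z) → Matches h y z A B →
    ∀ a, E a A → SRel C A a → ∀ b, E b B → SRel D B b → SRel h a b

theorem IsSingGraph.isClosedRel (hM : M ⊨ theory) {C g y : M} (hC : IsChoice C)
    (hg : IsSingGraph g y) : IsClosedRel C C g y y := by
  intro A B hA hB hAB a ha hCa b hb hCb
  simp only [Matches, hg.sRel_iff hM] at hAB ⊢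
  -- A diagonal relation can match the two complements only if they are equal.
  have : A = B := ext hM ha fun z => by grind
  subst this
  obtain ⟨c, -, hc⟩ := hC A ⟨a, ha⟩
  exact ⟨hA a ha, ((hc a).1 ⟨ha, hCa⟩).trans ((hc b).1 ⟨hb, hCb⟩).symm⟩

/-- Let `D` be the set of `a ∈ y` that `h` fails to relate to themselves. Then `h` matches the
complement of `D` with itself, so if `D` were nonempty, `h` would relate the chosen element of `D`
to itself. -/
theorem IsClosedRel.subset (hM : M ⊨ theory) {C g h y : M} (hC : IsChoice C)
    (hg : IsSingGraph g y) (hh : IsClosedRel C C h y y) {p : M} (hp : E p g) : E p h := by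
  -- The condition `¬ SRel h a a` is not stratified, so `D` is obtained as the domain of the
  -- difference of `g` and `h`.
  obtain ⟨D, hD⟩ : ∃ D : M, ∀ a, E a D ↔ ∃ p, (E p g ∧ ¬ E p h) ∧ ∃ s, IsOPair p a s :=
    StratDef.exists_set hM (n := 2) (σ := ![3, 3, 0])
      (R := fun x => ∃ p, (E p (x 0) ∧ ¬ E p (x 1)) ∧ ∃ s, IsOPair p (x 2) s)
      (have v0 : IsVar (M := M) ![3, 3, 0] 3 (fun x => x 0) := ⟨0, rfl, fun _ => rfl⟩
       have v1 : IsVar (M := M) ![3, 3, 0] 3 (fun x => x 1) := ⟨1, rfl, fun _ => rfl⟩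
       have v2 : IsVar (M := M) ![3, 3, 0] 0 (fun x => x 2) := ⟨2, rfl, fun _ => rfl⟩
       .ex 2 (.and (.and (.mem .last v0.lift) (.not (.mem .last v1.lift)))
        (.ex 0 (.isOPair IsVar.last.lift v2.lift.lift .last)))) ![g, h]
  replace hD (a : M) : E a D ↔ E a y ∧ ¬ SRel h a a := by
    rw [hD]
    constructor
    · rintro ⟨p, ⟨hpg, hph⟩, s, hps⟩
      obtain ⟨b, hb, hpb⟩ := (hg p).1 hpg
      obtain ⟨t, -, hpt⟩ := id hpb
      obtain ⟨rfl, -⟩ := hps.inj hM hpt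
      exact ⟨hb, (sRel_iff hM hpb).not.2 hph⟩
    · rintro ⟨ha, hah⟩
      obtain ⟨p, hp⟩ := exists_isSPair hM a a
      obtain ⟨s, -, hs⟩ := id hp
      exact ⟨p, ⟨(hg p).2 ⟨a, ha, hp⟩, (sRel_iff hM hp).not.1 hah⟩, s, hs⟩
  obtain ⟨a, ha, hpa⟩ := (hg p).1 hp
  rw [← sRel_iff hM hpa]
  by_contra hah
  obtain ⟨c, hcD, hc⟩ := hC D ⟨a, (hD a).2 ⟨ha, hah⟩⟩
  have hCc := ((hc c).2 rfl).2
  have hDy (b : M) (hb : E b D) : E b y := ((hD b).1 hb).1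
  have hfix (b : M) (hb : E b y) (hbD : ¬ E b D) : ∃ b', E b' y ∧ ¬ E b' D ∧
      SRel h b b' ∧ SRel h b' b := by
    have : SRel h b b := by_contra fun hn => hbD ((hD b).2 ⟨hb, hn⟩)
    exact ⟨b, hb, hbD, this, this⟩
  refine ((hD c).1 hcD).2 (hh D D hDy hDy ⟨fun b hb hbD => ?_, fun b hb hbD => ?_⟩
    c hcD hCc c hcD hCc)
  · obtain ⟨b', h1, h2, h3, -⟩ := hfix b hb hbD
    exact ⟨b', h1, h2, h3⟩
  · obtain ⟨b', h1, h2, -, h3⟩ := hfix b hb hbD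
    exact ⟨b', h1, h2, h3⟩

/-- The singleton graph of a strongly cantorian set is the intersection of the closed relations. -/
theorem IsSingGraph.mem_iff (hM : M ⊨ theory) {C g y : M} (hC : IsChoice C)
    (hg : IsSingGraph g y) (p : M) : E p g ↔ ∀ h, IsClosedRel C C h y y → E p h :=
  ⟨fun hp _ hh => hh.subset hM hC hg hp, fun hp => hp g (hg.isClosedRel hM hC)⟩

/-- `C` chooses from subsets of `y` and `D` from subsets of `z`, one type lower. This is why the
same choice function enters as two variables. -/
theorem StratDef.isClosedRel {C D h y z : (Fin n → M) → M} (hC : IsVar σ (k + 5) C)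
    (hD : IsVar σ (k + 4) D) (hh : IsVar σ (k + 4) h) (hy : IsVar σ (k + 2) y)
    (hz : IsVar σ (k + 1) z) :
    StratDef σ (fun x => IsClosedRel (C x) (D x) (h x) (y x) (z x)) :=
  have vA : IsVar (M := M) (Fin.snoc (Fin.snoc σ (k + 2) : Fin (n + 1) → ℕ) (k + 1) :
    Fin (n + 2) → ℕ) (k + 2) _ := IsVar.last.lift
  have vB : IsVar (M := M) (Fin.snoc (Fin.snoc σ (k + 2) : Fin (n + 1) → ℕ) (k + 1) :
    Fin (n + 2) → ℕ) (k + 1) _ := IsVar.last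
  .all (k + 2) <| .all (k + 1) <|
    .imp (.all (k + 1) (.imp (.mem .last vA.lift) (.mem .last hy.lift.lift.lift))) <|
    .imp (.all k (.imp (.mem .last vB.lift) (.mem .last hz.lift.lift.lift))) <|
    .imp (.and
      (.all (k + 1) (.imp (.mem .last hy.lift.lift.lift) (.imp (.not (.mem .last vA.lift))
        (.ex k (.and (.mem .last hz.lift.lift.lift.lift) (.and (.not (.mem .last vB.lift.lift))
          (.sRel hh.lift.lift.lift.lift IsVar.last.lift .last)))))))
      (.all k (.imp (.mem .last hz.lift.lift.lift) (.imp (.not (.mem .last vB.lift))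
        (.ex (k + 1) (.and (.mem .last hy.lift.lift.lift.lift)
          (.and (.not (.mem .last vA.lift.lift))
            (.sRel hh.lift.lift.lift.lift .last IsVar.last.lift)))))))) <|
    .all (k + 1) <| .imp (.mem .last vA.lift) <| .imp (.sRel hC.lift.lift.lift vA.lift .last) <|
    .all k <| .imp (.mem .last vB.lift.lift) <|
      .imp (.sRel hD.lift.lift.lift.lift vB.lift.lift .last) <|
    .sRel hh.lift.lift.lift.lift IsVar.last.lift .last

/-! ### Unions of strongly cantorian families -/

theorem exists_isUnion (hM : M ⊨ theory) (X : M) :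
    ∃ u : M, ∀ z, E z u ↔ ∃ y, E y X ∧ E z y :=
  StratDef.exists_set hM (n := 1) (σ := ![2, 0]) (R := fun x => ∃ y, E y (x 0) ∧ E (x 1) y)
    (have v0 : IsVar (M := M) ![2, 0] 2 (fun x => x 0) := ⟨0, rfl, fun _ => rfl⟩
     have v1 : IsVar (M := M) ![2, 0] 0 (fun x => x 1) := ⟨1, rfl, fun _ => rfl⟩
     .ex 1 (.and (.mem .last v0.lift) (.mem v1.lift .last))) ![X]

theorem exists_isSingGraph_union (hM : M ⊨ theory) (hC : M ⊨ choice) {X u : M}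
    (hX : ∃ j, IsSingGraph j X) (hy : ∀ y, E y X → ∃ g, IsSingGraph g y)
    (hu : ∀ z, E z u ↔ ∃ y, E y X ∧ E z y) : ∃ g, IsSingGraph g u := by
  obtain ⟨C, hC⟩ := exists_isChoice hM hC
  obtain ⟨j, hj⟩ := hX
  -- Here `y` has type 2 and `z` type 1; `j` forces them to be equal. The set `C` is supplied twice,
  -- at types 5 and 4.
  obtain ⟨G, hG⟩ : ∃ G : M, ∀ p, E p G ↔
      ∃ y z, SRel j y z ∧ ∀ h, IsClosedRel C C h y z → E p h :=
    StratDef.exists_set hM (n := 3) (σ := ![5, 5, 4, 3])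
      (R := fun x => ∃ y z, SRel (x 0) y z ∧
        ∀ h, IsClosedRel (x 1) (x 2) h y z → E (x 3) h)
      (have v0 : IsVar (M := M) ![5, 5, 4, 3] 5 (fun x => x 0) := ⟨0, rfl, fun _ => rfl⟩
       have v1 : IsVar (M := M) ![5, 5, 4, 3] 5 (fun x => x 1) := ⟨1, rfl, fun _ => rfl⟩
       have v2 : IsVar (M := M) ![5, 5, 4, 3] 4 (fun x => x 2) := ⟨2, rfl, fun _ => rfl⟩
       have v3 : IsVar (M := M) ![5, 5, 4, 3] 3 (fun x => x 3) := ⟨3, rfl, fun _ => rfl⟩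
       .ex 2 (.ex 1 (.and (.sRel v0.lift.lift IsVar.last.lift .last)
        (.all 4 (.imp (.isClosedRel (k := 0) v1.lift.lift.lift v2.lift.lift.lift .last
          IsVar.last.lift.lift IsVar.last.lift) (.mem v3.lift.lift.lift .last))))))
      ![j, C, C]
  refine ⟨G, fun p => (hG p).trans ⟨?_, ?_⟩⟩
  · rintro ⟨y, z, hyz, hp⟩
    obtain ⟨hyX, rfl⟩ := (hj.sRel_iff hM).1 hyz
    obtain ⟨g, hg⟩ := hy y hyX
    obtain ⟨a, ha, hpa⟩ := (hg p).1 ((hg.mem_iff hM hC p).2 hp)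
    exact ⟨a, (hu a).2 ⟨y, hyX, ha⟩, hpa⟩
  · rintro ⟨a, ha, hpa⟩
    obtain ⟨y, hyX, hay⟩ := (hu a).1 ha
    obtain ⟨g, hg⟩ := hy y hyX
    exact ⟨y, y, (hj.sRel_iff hM).2 ⟨hyX, rfl⟩,
      (hg.mem_iff hM hC p).1 ((hg p).2 ⟨a, hay, hpa⟩)⟩

end Semantics

end NFU

theorem mainTheorem11 : (NFU.theory ∪ {NFU.choice}) ⊨ᵇ NFU.SCU := by
  rw [models_sentence_iff]
  intro M
  have hM : M ⊨ NFU.theory := M.is_model.mono Set.subset_union_left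
  have hC : M ⊨ NFU.choice := M.is_model.realize_of_mem _ (.inr rfl)
  exact NFU.realize_SCU.2 fun X hX hy =>
    ⟨NFU.exists_isUnion hM X, fun _ hu => NFU.exists_isSingGraph_union hM hC hX hy hu⟩
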